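/- Let $k\in\mathbb N$ and $n=2^k$. Let $S\subseteq\mathbb Z_n\setminus\{0\}$ satisfy $-S=S$, and let $\mathrm{Cay}(\mathbb Z_n,S)$ be the circulant graph on $\mathbb Z_n$ in which $a,b$ are adjacent if and only if $a-b\in S$. Let $A$ be its adjacency matrix and $H(t)=\exp(-itA)$, $t\in\mathbb R$. Write $\mathbf e_u$ for the standard basis vector at $u\in\mathbb Z_n$, and for a divisor $d$ of $n$ put $S_n(d)=\{x\in\mathbb Z_n:\gcd(x,n)=d\}$. Suppose that $\mathrm{Cay}(\mathbb Z_n,S)$ is non-integral, that is, not all eigenvalues of $A$ are integers. Then there is a divisor $d$ of $n$ for which $S\cap S_n(d)$ is a non-empty proper subset of $S_n(d)$. Let $d$ be the least such divisor. 1. If $|S\cap S_n(d)|\equiv 2\pmod 4$, then $\mathrm{Cay}(\mathbb Z_n,S)$ has pretty good state transfer between $0$ and $n/2$ with respect to a sequence in $2\pi\mathbb Z$: there are a sequence $(t_m)$ in $2\pi\mathbb Z$ and $\gamma\in\mathbb C$ with $|\gamma|=1$ such that $\lim_{m\to\infty}H(t_m)\mathbf e_0=\gamma\,\mathbf e_{n/2}$.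 2. If $|S\cap S_n(d)|\equiv 0\pmod 4$, then $\mathrm{Cay}(\mathbb Z_n,S)$ is almost periodic with respect to a sequence in $2\pi\mathbb Z$ tending to infinity: there are a sequence $(t_m)$ in $2\pi\mathbb Z$ with $t_m\to+\infty$ and $\gamma\in\mathbb C$ with $|\gamma|=1$ such that $\lim_{m\to\infty}H(t_m)=\gamma I$. -/

import Mathlib

open Filter Topology
open scoped Matrix

namespace CirculantPGST

section Graph

variable {V : Type*} [Fintype V] [DecidableEq V]

/-- The transition matrix `H(t) = exp(-itA)` of a finite simple graph with adjacency matrix `A`. -/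
noncomputable def transitionMatrix (G : SimpleGraph V) [DecidableRel G.Adj] (t : ℝ) :
    Matrix V V ℂ :=
  NormedSpace.exp ((-(Complex.I * (t : ℂ))) • G.adjMatrix ℂ)

/-- Pretty good state transfer from `u` to `v` along the time sequence `t`:
`H(t_m) e_u → γ e_v` for some complex number `γ` of unit modulus. -/
def HasPGSTAlong (G : SimpleGraph V) [DecidableRel G.Adj] (u v : V) (t : ℕ → ℝ) : Prop :=
  ∃ γ : ℂ, ‖γ‖ = 1 ∧
    Tendsto (fun m => transitionMatrix G (t m) *ᵥ (Pi.single u 1 : V → ℂ)) atTop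
      (𝓝 (γ • (Pi.single v 1 : V → ℂ)))

/-- Almost periodicity along the time sequence `t`:
`H(t_m) → γ I` for some complex number `γ` of unit modulus. -/
def IsAlmostPeriodicAlong (G : SimpleGraph V) [DecidableRel G.Adj] (t : ℕ → ℝ) : Prop :=
  ∃ γ : ℂ, ‖γ‖ = 1 ∧
    Tendsto (fun m => transitionMatrix G (t m)) atTop (𝓝 (γ • (1 : Matrix V V ℂ)))

/-- A graph is integral if all eigenvalues of its adjacency matrix are integers. -/
def IsIntegralGraph (G : SimpleGraph V) [DecidableRel G.Adj] : Prop :=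
  ∀ μ : ℂ, Module.End.HasEigenvalue (Matrix.toLin' (G.adjMatrix ℂ)) μ → ∃ z : ℤ, μ = z

end Graph

/-- The set `S_n(d)` of all `x` in `ℤ/nℤ` with `gcd(x, n) = d`. -/
def gcdClass (n : ℕ) [NeZero n] (d : ℕ) : Finset (ZMod n) :=
  Finset.univ.filter (fun x => Nat.gcd x.val n = d)

end CirculantPGST

/-! The characters of `ZMod n` diagonalize A, with real eigenvalues λ_r = ∑_{s∈S} χ(rs). Hence H(t)
tends to translation by a as soon as exp(-itλ_r) → χ(-ra) for every r. At times t = 2πq this is a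
simultaneous approximation problem qλ_r ≈ α_r mod 1. Kronecker's theorem
(`frequently_norm_exp_sub_exp_lt`) solves it when every integer relation ∑ l_r λ_r ∈ ℤ forces ∑ l_r
α_r ∈ ℤ.

For almost periodicity α = 0, and the condition is trivial. For transfer to n/2, α_r = r/2, and the
condition says that ∑ l_r r is even (`two_dvd_sum_mul_val`). To see this, write the relation as ∑
p(x)χ(x) = m, where p(x) sums l_r over the pairs (r, s) with rs = x. Irreducibility of the
cyclotomic polynomial of order 2^k makes p invariant under x ↦ x + n/2 away from 0 and n/2; symmetry
of S makes p even. On S_n(d) these two involutions have orbits of size 4, so 4 divides the sum of p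
over this class. Counted by r instead, that sum is congruent to 2∑ l_r r mod 4, by minimality of d
and |S ∩ S_n(d)| ≡ 2.

A least d exists because otherwise S is a union of gcd classes, whose character sums are integers
(`circulantEigenvalue_mem_int`). -/

namespace CirculantPGST

/-! ### Kronecker approximation by averaging powers of |1 + w|². -/

section Kronecker

lemma tendsto_cesaro_pow {z : ℂ} (hz : ‖z‖ = 1) (Q : ℕ) :
    Tendsto (fun N : ℕ => (∑ q ∈ Finset.range N, z ^ (q + Q)) / (N : ℂ)) atTop
      (𝓝 (if z = 1 then 1 else 0)) := by
  split_ifs with h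
  · refine tendsto_const_nhds.congr' ?_
    filter_upwards [eventually_gt_atTop 0] with N hN
    have : (N : ℂ) ≠ 0 := by exact_mod_cast hN.ne'
    simp [h, this]
  · have hz1 : 0 < ‖z - 1‖ := norm_pos_iff.2 (sub_ne_zero.2 h)
    refine squeeze_zero_norm (a := fun N : ℕ => (2 / ‖z - 1‖) / (N : ℝ)) (fun N => ?_)
      (tendsto_const_div_atTop_nhds_zero_nat _)
    rw [norm_div, Complex.norm_natCast]
    gcongr
    simp_rw [pow_add]
    rw [← Finset.sum_mul, norm_mul, norm_pow, hz, one_pow, mul_one, geom_sum_eq h, norm_div]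
    gcongr
    calc ‖z ^ N - 1‖ ≤ ‖z ^ N‖ + ‖(1 : ℂ)‖ := norm_sub_le _ _
      _ = 2 := by rw [norm_pow, hz]; norm_num

lemma norm_one_add_sq {w : ℂ} (hw : ‖w‖ = 1) : ‖1 + w‖ ^ 2 = 4 - ‖w - 1‖ ^ 2 := by
  have := parallelogram_law_with_norm ℝ w 1
  rw [hw, norm_one, add_comm w 1] at this
  linarith

/-- On the unit circle the conjugate of w is w⁻¹, so |1 + w|² = (1 + w)² w⁻¹ and the binomial
theorem applies. The constant coefficient is the central binomial coefficient. -/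
lemma norm_one_add_sq_pow_eq_sum {w : ℂ} (hw : ‖w‖ = 1) (p : ℕ) :
    (((‖1 + w‖ ^ 2) ^ p : ℝ) : ℂ) =
      ∑ i ∈ Finset.range (2 * p + 1), ((2 * p).choose i : ℂ) * w ^ ((i : ℤ) - p) := by
  have hw0 : w ≠ 0 := norm_pos_iff.1 (by rw [hw]; norm_num)
  have h1 : (((‖1 + w‖ ^ 2 : ℝ)) : ℂ) = (1 + w) ^ 2 * w⁻¹ := by
    rw [Complex.inv_eq_conj hw]
    push_cast
    rw [← Complex.mul_conj']
    have : w * (starRingEnd ℂ) w = 1 := by rw [Complex.mul_conj', hw]; norm_num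
    simp only [map_add, map_one]
    linear_combination -(1 + w) * this
  rw [Complex.ofReal_pow, h1, mul_pow, ← pow_mul, add_comm 1 w, add_pow, Finset.sum_mul]
  refine Finset.sum_congr rfl fun i _ => ?_
  rw [zpow_sub₀ hw0, zpow_natCast, zpow_natCast, inv_pow]
  simp
  ring

/-- Mean value of a product of Fejér-type kernels dominates its constant coefficient. -/
lemma centralBinom_pow_le_of_eventually_le {ι : Type*} [Fintype ι] [DecidableEq ι]
    (x α : ι → ℝ)
    (h : ∀ (l : ι → ℤ) (m : ℤ), ∑ j, l j * x j = m → ∃ m' : ℤ, ∑ j, l j * α j = m')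
    (p : ℕ) (B : ℝ)
    (hB : ∀ᶠ q : ℕ in atTop,
      ∏ j, (‖1 + Complex.exp (2 * Real.pi * Complex.I * (q * x j - α j))‖ ^ 2) ^ p ≤ B) :
    (p.centralBinom : ℝ) ^ Fintype.card ι ≤ B := by
  obtain ⟨Q, hQ⟩ := eventually_atTop.1 hB
  set T : Finset (ι → ℕ) := Fintype.piFinset fun _ : ι => Finset.range (2 * p + 1) with hT
  set c : (ι → ℕ) → ℝ := fun i => ∏ j, ((2 * p).choose (i j) : ℝ) with hc
  set Z : (ι → ℕ) → ℂ := fun i =>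
    Complex.exp (2 * Real.pi * Complex.I * ∑ j, ((i j : ℤ) - p : ℤ) * x j) with hZ
  set W : (ι → ℕ) → ℂ := fun i =>
    Complex.exp (-(2 * Real.pi * Complex.I * ∑ j, ((i j : ℤ) - p : ℤ) * α j)) with hW
  have hexp : ∀ r : ℝ, ‖Complex.exp (2 * Real.pi * Complex.I * r)‖ = 1 := fun r => by
    rw [show (2 * Real.pi * Complex.I * r : ℂ) = ((2 * Real.pi * r : ℝ) : ℂ) * Complex.I by
      push_cast; ring]
    exact Complex.norm_exp_ofReal_mul_I _
  have hZ1 : ∀ i, ‖Z i‖ = 1 := fun i => by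
    have := hexp (∑ j, ((i j : ℤ) - p : ℤ) * x j)
    push_cast at this
    simpa [hZ] using this
  have hF : ∀ q : ℕ, ((∏ j, (‖1 + Complex.exp (2 * Real.pi * Complex.I * (q * x j - α j))‖ ^ 2) ^ p
      : ℝ) : ℂ) = ∑ i ∈ T, c i * W i * Z i ^ q := fun q => by
    rw [Complex.ofReal_prod]
    have : ∀ j, (((‖1 + Complex.exp (2 * Real.pi * Complex.I * (q * x j - α j))‖ ^ 2) ^ p : ℝ) : ℂ)
        = ∑ i ∈ Finset.range (2 * p + 1), ((2 * p).choose i : ℂ) *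
          (Complex.exp (2 * Real.pi * Complex.I * (q * x j - α j))) ^ ((i : ℤ) - p) := fun j => by
      refine norm_one_add_sq_pow_eq_sum ?_ p
      have := hexp (q * x j - α j)
      push_cast at this
      exact this
    rw [Finset.prod_congr rfl fun j _ => this j, Finset.prod_univ_sum]
    refine Finset.sum_congr rfl fun i _ => ?_
    rw [Finset.prod_mul_distrib, mul_assoc (c i : ℂ)]
    congr 1
    · simp [hc]
    · simp_rw [hW, hZ, ← Complex.exp_int_mul, ← Complex.exp_nat_mul, ← Complex.exp_sum,
        ← Complex.exp_add]
      congr 1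
      push_cast
      simp_rw [Finset.mul_sum]
      rw [← Finset.sum_neg_distrib, ← Finset.sum_add_distrib]
      refine Finset.sum_congr rfl fun j _ => ?_
      ring
  -- A frequency that survives averaging is an integer relation among the x j; the hypothesis then
  -- makes its phase trivial, so only nonnegative terms remain in the limit.
  have hterm : ∀ i, Z i = 1 → W i = 1 := fun i hi => by
    obtain ⟨m, hm⟩ := Complex.exp_eq_one_iff.1 hi
    have h2 : (2 * Real.pi * Complex.I : ℂ) ≠ 0 := Complex.two_pi_I_ne_zero
    have h3 : ((∑ j, (((i j : ℤ) - p : ℤ) : ℝ) * x j : ℝ) : ℂ) = m := by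
      apply mul_left_cancel₀ h2
      rw [hm]; ring
    obtain ⟨m', hm'⟩ := h (fun j => (i j : ℤ) - p) m (by exact_mod_cast h3)
    have h4 : ((∑ j, (((i j : ℤ) - p : ℤ) : ℝ) * α j : ℝ) : ℂ) = m' := by exact_mod_cast hm'
    rw [hW]
    refine Complex.exp_eq_one_iff.2 ⟨-m', ?_⟩
    rw [h4]; push_cast; ring
  have hlim : Tendsto (fun N : ℕ => (∑ q ∈ Finset.range N,
      ((∏ j, (‖1 + Complex.exp (2 * Real.pi * Complex.I * ((q + Q : ℕ) * x j - α j))‖ ^ 2) ^ p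
      : ℝ) : ℂ)) / (N : ℂ)) atTop (𝓝 (∑ i ∈ T, c i * W i * (if Z i = 1 then 1 else 0))) := by
    have := tendsto_finsetSum T fun i _ =>
      (tendsto_cesaro_pow (hZ1 i) Q).const_mul ((c i : ℂ) * W i)
    refine this.congr fun N => ?_
    simp_rw [hF, mul_div_assoc', Finset.mul_sum]
    rw [← Finset.sum_div, Finset.sum_comm]
  have hL : (∑ i ∈ T, (c i : ℂ) * W i * (if Z i = 1 then 1 else 0)) =
      ((∑ i ∈ T, c i * (if Z i = 1 then 1 else 0) : ℝ) : ℂ) := by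
    push_cast
    refine Finset.sum_congr rfl fun i _ => ?_
    split_ifs with hi
    · rw [hterm i hi]; simp
    · simp
  rw [hL] at hlim
  have hre := (Complex.continuous_re.tendsto _).comp hlim
  rw [Complex.ofReal_re] at hre
  have hle : ∑ i ∈ T, c i * (if Z i = 1 then 1 else 0 : ℝ) ≤ B := by
    refine le_of_tendsto hre ?_
    filter_upwards [eventually_gt_atTop 0] with N hN
    have hN' : (0 : ℝ) < N := by exact_mod_cast hN
    rw [Function.comp_apply, ← Complex.ofReal_sum, ← Complex.ofReal_natCast, ← Complex.ofReal_div,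
      Complex.ofReal_re, div_le_iff₀ hN']
    calc _ ≤ ∑ q ∈ Finset.range N, B :=
          Finset.sum_le_sum fun q _ => hQ (q + Q) (Nat.le_add_left _ _)
      _ = B * N := by simp [mul_comm]
  refine le_trans ?_ hle
  -- The constant index p is the zero frequency, which always survives.
  have hmem : (fun _ : ι => p) ∈ T := by simp [hT]; omega
  have := Finset.single_le_sum (f := fun i => c i * (if Z i = 1 then 1 else 0 : ℝ)) (s := T)
    (fun i _ => by
      have : 0 ≤ c i := Finset.prod_nonneg fun j _ => Nat.cast_nonneg _
      split_ifs <;> simp [this]) hmem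
  refine le_trans (le_of_eq ?_) this
  simp [hc, hZ, Nat.centralBinom]

/-- Kronecker's approximation theorem for integer multiples. -/
theorem frequently_norm_exp_sub_exp_lt {ι : Type*} [Fintype ι] (x α : ι → ℝ)
    (h : ∀ (l : ι → ℤ) (m : ℤ), ∑ j, l j * x j = m → ∃ m' : ℤ, ∑ j, l j * α j = m')
    {ε : ℝ} (hε : 0 < ε) :
    ∃ᶠ q : ℕ in atTop, ∀ j,
      ‖Complex.exp (2 * Real.pi * Complex.I * (q * x j - α j)) - 1‖ < ε := by
  classical
  intro hcon
  set w : ℕ → ι → ℂ := fun q j => Complex.exp (2 * Real.pi * Complex.I * (q * x j - α j)) with hw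
  have hw1 : ∀ q j, ‖w q j‖ = 1 := fun q j => by
    simp only [hw]
    rw [show (2 * Real.pi * Complex.I * (q * x j - α j) : ℂ)
      = ((2 * Real.pi * (q * x j - α j) : ℝ) : ℂ) * Complex.I by push_cast; ring]
    exact Complex.norm_exp_ofReal_mul_I _
  -- By the parallelogram law, a factor with |w - 1| ≥ ε has |1 + w|² ≤ 4ρ, while the other factors
  -- are at most 4.
  set ρ : ℝ := (4 - ε ^ 2) / 4 with hρ
  have hbd : ∀ᶠ q : ℕ in atTop, 0 ≤ ρ ∧ ∀ p : ℕ,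
      ∏ j, (‖1 + w q j‖ ^ 2) ^ p ≤ (4 ^ p) ^ Fintype.card ι * ρ ^ p := by
    filter_upwards [hcon] with q hq
    push Not at hq
    obtain ⟨j₀, hj₀⟩ := hq
    have hup : ∀ j, ‖1 + w q j‖ ^ 2 ≤ 4 := fun j => by
      rw [norm_one_add_sq (hw1 q j)]; linarith [sq_nonneg ‖w q j - 1‖]
    have hj : ‖1 + w q j₀‖ ^ 2 ≤ 4 - ε ^ 2 := by
      rw [norm_one_add_sq (hw1 q j₀)]
      have : ε ^ 2 ≤ ‖w q j₀ - 1‖ ^ 2 := by gcongr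
      linarith
    have hpos : 0 ≤ 4 - ε ^ 2 := le_trans (sq_nonneg _) hj
    refine ⟨by positivity, fun p => ?_⟩
    rw [← Finset.mul_prod_erase _ _ (Finset.mem_univ j₀)]
    have hcard : Fintype.card ι = (Finset.univ.erase j₀).card + 1 := by
      rw [Finset.card_erase_of_mem (Finset.mem_univ _), Finset.card_univ]
      have : 0 < Fintype.card ι := Fintype.card_pos_iff.2 ⟨j₀⟩
      omega
    calc _ ≤ (4 - ε ^ 2) ^ p * ∏ j ∈ Finset.univ.erase j₀, (4 : ℝ) ^ p := by
          gcongr with j _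
          exact hup j
      _ = _ := by
          rw [Finset.prod_const, hcard, hρ, div_pow, pow_succ]
          field_simp
          ring
  have hρ0 : 0 ≤ ρ := hbd.exists.choose_spec.1
  have hρ1 : ρ < 1 := by rw [hρ]; nlinarith [sq_pos_of_pos hε]
  -- The central binomial coefficient is below 4 ^ p only by a factor linear in p, so the mean value
  -- loses polynomially while the assumed bound decays like ρ ^ p.
  have key : ∀ p : ℕ, 0 < p → 1 ≤ (2 : ℝ) ^ Fintype.card ι * ((p : ℝ) ^ Fintype.card ι * ρ ^ p) := by
    intro p hp
    have h1 := centralBinom_pow_le_of_eventually_le x α h p _ (hbd.mono fun q hq => hq.2 p)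
    have h2 : (4 : ℝ) ^ p ≤ 2 * p * p.centralBinom := by
      exact_mod_cast Nat.four_pow_le_two_mul_self_mul_centralBinom p hp
    have h3 : ((4 : ℝ) ^ p) ^ Fintype.card ι ≤
        (2 * p) ^ Fintype.card ι * ((4 ^ p) ^ Fintype.card ι * ρ ^ p) :=
      calc ((4 : ℝ) ^ p) ^ Fintype.card ι ≤ (2 * p * p.centralBinom) ^ Fintype.card ι := by gcongr
        _ = (2 * p) ^ Fintype.card ι * (p.centralBinom : ℝ) ^ Fintype.card ι := mul_pow _ _ _
        _ ≤ _ := by gcongr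
    have h4 : (0 : ℝ) < ((4 : ℝ) ^ p) ^ Fintype.card ι := by positivity
    refine le_of_mul_le_mul_left ?_ h4
    rw [mul_one]
    refine h3.trans (le_of_eq ?_)
    rw [mul_pow]; ring
  have hlim : Tendsto (fun p : ℕ => (2 : ℝ) ^ Fintype.card ι * ((p : ℝ) ^ Fintype.card ι * ρ ^ p))
      atTop (𝓝 ((2 : ℝ) ^ Fintype.card ι * 0)) :=
    (tendsto_pow_const_mul_const_pow_of_abs_lt_one _ (by rwa [abs_of_nonneg hρ0])).const_mul _
  rw [mul_zero] at hlim
  obtain ⟨p, hp0, hp⟩ := ((eventually_gt_atTop 0).and (hlim.eventually_lt_const one_pos)).exists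
  exact absurd (key p hp0) (not_le.2 hp)

end Kronecker

end CirculantPGST

namespace CirculantPGST

/-! ### Matrix exponential on an eigenvector. -/

section MatrixExp

variable {V : Type*} [Fintype V] [DecidableEq V]

attribute [local instance] Matrix.linftyOpNormedRing Matrix.linftyOpNormedAlgebra

lemma exp_mulVec_of_mulVec_eq_smul {M : Matrix V V ℂ} {v : V → ℂ} {μ : ℂ} (h : M *ᵥ v = μ • v) :
    NormedSpace.exp M *ᵥ v = Complex.exp μ • v := by
  have hpow : ∀ k : ℕ, M ^ k *ᵥ v = μ ^ k • v := fun k => by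
    induction k with
    | zero => simp
    | succ k ih => rw [pow_succ, ← Matrix.mulVec_mulVec, h, Matrix.mulVec_smul, ih, smul_smul,
        pow_succ, mul_comm]
  have h1 := NormedSpace.exp_series_hasSum_exp' (𝕂 := ℂ) M
  have h2 := h1.map (⟨⟨fun N : Matrix V V ℂ => N *ᵥ v, Matrix.zero_mulVec v⟩,
    fun a b => Matrix.add_mulVec a b v⟩ : Matrix V V ℂ →+ (V → ℂ))
    (Continuous.matrix_mulVec continuous_id continuous_const)
  have h3 := (NormedSpace.exp_series_hasSum_exp' (𝕂 := ℂ) μ).smul_const v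
  rw [← Complex.exp_eq_exp_ℂ] at h3
  refine h2.unique (h3.congr_fun ?_)
  intro k
  simp [Matrix.smul_mulVec, hpow, smul_smul]

end MatrixExp

/-! ### Diagonalization of circulant graphs by characters. -/

section Spectrum

lemma circulantGraph_adj_iff {n : ℕ} {S : Finset (ZMod n)} (hzero : (0 : ZMod n) ∉ S)
    (hsymm : ∀ s ∈ S, -s ∈ S) (u v : ZMod n) :
    (SimpleGraph.circulantGraph (S : Set (ZMod n))).Adj u v ↔ v - u ∈ S := by
  simp only [SimpleGraph.circulantGraph_adj, Finset.mem_coe]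
  constructor
  · rintro ⟨_, h | h⟩
    · have := hsymm _ h
      rwa [neg_sub] at this
    · exact h
  · intro h
    refine ⟨?_, Or.inr h⟩
    rintro rfl
    exact hzero (by simpa using h)

variable {n : ℕ} [NeZero n]

/-- The eigenvalue of the circulant graph with connection set `S` at the character `r`. -/
noncomputable def circulantEigenvalue (S : Finset (ZMod n)) (r : ZMod n) : ℂ :=
  ∑ s ∈ S, ZMod.stdAddChar (r * s)

lemma stdAddChar_neg_eq_conj (x : ZMod n) :
    ZMod.stdAddChar (-x) = (starRingEnd ℂ) (ZMod.stdAddChar x) :=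
  AddChar.map_neg_eq_conj _ _

lemma circulantEigenvalue_eq_ofReal {S : Finset (ZMod n)} (hsymm : ∀ s ∈ S, -s ∈ S) (r : ZMod n) :
    circulantEigenvalue S r = ((circulantEigenvalue S r).re : ℂ) := by
  refine (Complex.conj_eq_iff_re.1 ?_).symm
  rw [circulantEigenvalue, map_sum]
  refine Finset.sum_nbij' (fun s => -s) (fun s => -s) hsymm hsymm (by simp) (by simp) ?_
  intro s _
  rw [mul_neg, stdAddChar_neg_eq_conj]

lemma sum_stdAddChar_mul (x : ZMod n) :
    ∑ r : ZMod n, ZMod.stdAddChar (r * x) = if x = 0 then (n : ℂ) else 0 := by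
  rw [AddChar.sum_mulShift x (ZMod.isPrimitive_stdAddChar n), ZMod.card]
  split_ifs <;> simp

lemma single_eq_sum_stdAddChar (u : ZMod n) :
    (Pi.single u 1 : ZMod n → ℂ) =
      (n : ℂ)⁻¹ • ∑ r : ZMod n, ZMod.stdAddChar (-(r * u)) • fun v => ZMod.stdAddChar (r * v) := by
  have hn : (n : ℂ) ≠ 0 := NeZero.ne _
  ext v
  simp only [Pi.smul_apply, Finset.sum_apply, smul_eq_mul, ← AddChar.map_add_eq_mul]
  rw [Finset.sum_congr rfl fun r _ => by rw [show -(r * u) + r * v = r * (v - u) by ring],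
    sum_stdAddChar_mul, Pi.single_apply]
  simp only [sub_eq_zero]
  split_ifs <;> simp [hn]

variable {S : Finset (ZMod n)} [DecidableRel (SimpleGraph.circulantGraph (S : Set (ZMod n))).Adj]

lemma adjMatrix_mulVec_stdAddChar (hzero : (0 : ZMod n) ∉ S) (hsymm : ∀ s ∈ S, -s ∈ S)
    (r : ZMod n) :
    (SimpleGraph.circulantGraph (S : Set (ZMod n))).adjMatrix ℂ *ᵥ
      (fun v => ZMod.stdAddChar (r * v)) =
      circulantEigenvalue S r • fun v => (ZMod.stdAddChar (r * v) : ℂ) := by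
  ext u
  simp only [Matrix.mulVec, dotProduct, SimpleGraph.adjMatrix_apply,
    circulantGraph_adj_iff hzero hsymm, Pi.smul_apply, smul_eq_mul, circulantEigenvalue,
    Finset.sum_mul, ite_mul, one_mul, zero_mul, ← AddChar.map_add_eq_mul]
  rw [← Finset.sum_filter]
  refine Finset.sum_nbij' (fun v => v - u) (fun s => s + u) (by simp) (by simp) (by simp) (by simp) ?_
  intro v _
  congr 1
  ring

lemma transitionMatrix_mulVec_single (hzero : (0 : ZMod n) ∉ S) (hsymm : ∀ s ∈ S, -s ∈ S)
    (t : ℝ) (u : ZMod n) :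
    transitionMatrix (SimpleGraph.circulantGraph (S : Set (ZMod n))) t *ᵥ Pi.single u 1 =
      (n : ℂ)⁻¹ • ∑ r : ZMod n, (Complex.exp (-(Complex.I * t) * circulantEigenvalue S r) *
        ZMod.stdAddChar (-(r * u))) • fun v => (ZMod.stdAddChar (r * v) : ℂ) := by
  rw [single_eq_sum_stdAddChar, Matrix.mulVec_smul, Matrix.mulVec_sum]
  congr 1
  refine Finset.sum_congr rfl fun r _ => ?_
  have h : ((-(Complex.I * (t : ℂ))) •
      (SimpleGraph.circulantGraph (S : Set (ZMod n))).adjMatrix ℂ) *ᵥ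
      (fun v => (ZMod.stdAddChar (r * v) : ℂ)) =
      (-(Complex.I * t) * circulantEigenvalue S r) • fun v => (ZMod.stdAddChar (r * v) : ℂ) := by
    rw [Matrix.smul_mulVec, adjMatrix_mulVec_stdAddChar hzero hsymm, smul_smul]
  rw [Matrix.mulVec_smul, transitionMatrix, exp_mulVec_of_mulVec_eq_smul h, smul_smul, mul_comm]

lemma tendsto_transitionMatrix_mulVec_single (hzero : (0 : ZMod n) ∉ S)
    (hsymm : ∀ s ∈ S, -s ∈ S) {t : ℕ → ℝ} {a : ZMod n}
    (h : ∀ r, Tendsto (fun m => Complex.exp (-(Complex.I * t m) * circulantEigenvalue S r)) atTop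
      (𝓝 (ZMod.stdAddChar (-(r * a))))) (u : ZMod n) :
    Tendsto (fun m => transitionMatrix (SimpleGraph.circulantGraph (S : Set (ZMod n))) (t m) *ᵥ
      (Pi.single u 1 : ZMod n → ℂ)) atTop (𝓝 (Pi.single (u + a) 1)) := by
  simp_rw [transitionMatrix_mulVec_single hzero hsymm]
  rw [single_eq_sum_stdAddChar (u + a)]
  refine Tendsto.const_smul (tendsto_finsetSum _ fun r _ => ?_) _
  rw [show -(r * (u + a)) = -(r * a) + -(r * u) by ring, AddChar.map_add_eq_mul]
  exact ((h r).mul_const _).smul_const _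

/-- As A is symmetric, an eigenvector for any other μ pairs to zero with every character; the
characters span, so it vanishes. -/
lemma exists_eq_circulantEigenvalue (hzero : (0 : ZMod n) ∉ S) (hsymm : ∀ s ∈ S, -s ∈ S) {μ : ℂ}
    (hμ : Module.End.HasEigenvalue
      (Matrix.toLin' ((SimpleGraph.circulantGraph (S : Set (ZMod n))).adjMatrix ℂ)) μ) :
    ∃ r, μ = circulantEigenvalue S r := by
  obtain ⟨v, hv⟩ := hμ.exists_hasEigenvector
  by_contra! hne
  have hA := hv.apply_eq_smul
  rw [Matrix.toLin'_apply] at hA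
  have hdot : ∀ r : ZMod n, (fun v => (ZMod.stdAddChar (r * v) : ℂ)) ⬝ᵥ v = 0 := fun r => by
    have h1 : (fun v => (ZMod.stdAddChar (r * v) : ℂ)) ⬝ᵥ
        ((SimpleGraph.circulantGraph (S : Set (ZMod n))).adjMatrix ℂ *ᵥ v) =
        circulantEigenvalue S r * ((fun v => (ZMod.stdAddChar (r * v) : ℂ)) ⬝ᵥ v) := by
      rw [Matrix.dotProduct_mulVec, ← Matrix.mulVec_transpose, SimpleGraph.transpose_adjMatrix,
        adjMatrix_mulVec_stdAddChar hzero hsymm, smul_dotProduct, smul_eq_mul]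
    rw [hA, dotProduct_smul, smul_eq_mul] at h1
    rcases mul_eq_mul_right_iff.1 h1 with h2 | h2
    · exact absurd h2 (hne r)
    · exact h2
  refine hv.2 (funext fun u => ?_)
  have : (Pi.single u 1 : ZMod n → ℂ) ⬝ᵥ v = 0 := by
    rw [single_eq_sum_stdAddChar, smul_dotProduct, sum_dotProduct]
    simp [smul_dotProduct, hdot]
  simpa using this

end Spectrum

end CirculantPGST

namespace CirculantPGST

/-! ### Gcd classes modulo a power of two. -/

section TwoPower

lemma gcd_two_pow_eq_iff {k e : ℕ} (he : e ∣ 2 ^ k) (hne : e ≠ 2 ^ k) (a : ℕ) :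
    Nat.gcd a (2 ^ k) = e ↔ ∃ b, Odd b ∧ a = e * b := by
  obtain ⟨j, hj, rfl⟩ := (Nat.dvd_prime_pow Nat.prime_two).1 he
  have hjk : j < k := lt_of_le_of_ne hj fun h => hne (by rw [h])
  constructor
  · intro h
    obtain ⟨b, hb⟩ : 2 ^ j ∣ a := h ▸ Nat.gcd_dvd_left _ _
    refine ⟨b, ?_, hb⟩
    by_contra hodd
    obtain ⟨c, rfl⟩ := (Nat.not_odd_iff_even.1 hodd).two_dvd
    have : 2 ^ (j + 1) ∣ 2 ^ j := by
      conv_rhs => rw [← h]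
      exact Nat.dvd_gcd ⟨c, by rw [hb]; ring⟩ (pow_dvd_pow 2 hjk)
    exact absurd ((Nat.pow_dvd_pow_iff_le_right (by norm_num)).1 this) (by omega)
  · rintro ⟨b, hb, rfl⟩
    conv_lhs => rw [show k = j + (k - j) by omega, pow_add, Nat.gcd_mul_left]
    rw [(Nat.Coprime.pow_right _ hb.coprime_two_right : Nat.gcd b (2 ^ (k - j)) = 1), mul_one]

/-- Additivity of the 2-adic valuation; excluding d = 2 ^ k avoids truncation by the gcd. -/
lemma gcd_mul_two_pow_eq_iff {k d : ℕ} (hd : d ∣ 2 ^ k) (hne : d ≠ 2 ^ k) (a b : ℕ) :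
    Nat.gcd (a * b) (2 ^ k) = d ↔ Nat.gcd a (2 ^ k) * Nat.gcd b (2 ^ k) = d := by
  have hlt : d < 2 ^ k := lt_of_le_of_ne (Nat.le_of_dvd (by positivity) hd) hne
  have hd0 : 0 < d := Nat.pos_of_dvd_of_pos hd (by positivity)
  have aux : ∀ x, Nat.gcd x (2 ^ k) ∣ d → ∃ b, Odd b ∧ x = Nat.gcd x (2 ^ k) * b := fun x hx =>
    (gcd_two_pow_eq_iff (Nat.gcd_dvd_right _ _)
      (ne_of_lt ((Nat.le_of_dvd hd0 hx).trans_lt hlt)) x).1 rfl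
  constructor
  · intro h
    obtain ⟨a', ha', haa⟩ := aux a (h ▸ Nat.gcd_dvd_gcd_mul_right_left _ _ _)
    obtain ⟨b', hb', hbb⟩ := aux b (h ▸ Nat.gcd_dvd_gcd_mul_left_left _ _ _)
    obtain ⟨c, hc, hcc⟩ := (gcd_two_pow_eq_iff hd hne _).1 h
    have heq : (Nat.gcd a (2 ^ k) * Nat.gcd b (2 ^ k)) * (a' * b') = d * c := by
      rw [← hcc]; conv_rhs => rw [haa, hbb]
      ring
    obtain ⟨i, -, hi⟩ := (Nat.dvd_prime_pow Nat.prime_two).1 (Nat.gcd_dvd_right a (2 ^ k))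
    obtain ⟨i', -, hi'⟩ := (Nat.dvd_prime_pow Nat.prime_two).1 (Nat.gcd_dvd_right b (2 ^ k))
    obtain ⟨j, -, rfl⟩ := (Nat.dvd_prime_pow Nat.prime_two).1 hd
    rw [hi, hi'] at heq ⊢
    have cop : ∀ (x y : ℕ), Odd y → Nat.Coprime (2 ^ x) y := fun x y hy =>
      Nat.Coprime.pow_left _ hy.coprime_two_left
    apply Nat.dvd_antisymm
    · refine Nat.Coprime.dvd_of_dvd_mul_right ?_ (Dvd.intro _ heq)
      rw [← pow_add]
      exact cop _ _ hc
    · exact Nat.Coprime.dvd_of_dvd_mul_right (cop _ _ (ha'.mul hb')) (Dvd.intro _ heq.symm)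
  · intro h
    obtain ⟨a', ha', haa⟩ := aux a (h ▸ dvd_mul_right _ _)
    obtain ⟨b', hb', hbb⟩ := aux b (h ▸ dvd_mul_left _ _)
    refine (gcd_two_pow_eq_iff hd hne _).2 ⟨a' * b', ha'.mul hb', ?_⟩
    rw [← h]
    conv_lhs => rw [haa, hbb]
    ring

lemma natCast_mem_gcdClass {n : ℕ} [NeZero n] {e a : ℕ} :
    (a : ZMod n) ∈ gcdClass n e ↔ Nat.gcd a n = e := by
  simp only [gcdClass, Finset.mem_filter, Finset.mem_univ, true_and, ZMod.val_natCast]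
  rw [← Nat.gcd_rec, Nat.gcd_comm]

lemma mem_gcdClass {n : ℕ} [NeZero n] {e : ℕ} {x : ZMod n} :
    x ∈ gcdClass n e ↔ Nat.gcd x.val n = e := by
  simp [gcdClass]

lemma gcdClass_self {n : ℕ} [NeZero n] : gcdClass n n = {0} := by
  ext x
  rw [mem_gcdClass, Finset.mem_singleton, Nat.gcd_eq_right_iff_dvd]
  constructor
  · intro h
    exact (ZMod.val_eq_zero x).1 (Nat.eq_zero_of_dvd_of_lt h (ZMod.val_lt x))
  · rintro rfl; simp

variable {k : ℕ}

lemma mem_gcdClass_two_pow_iff {e : ℕ} (he : e ∣ 2 ^ k) (hne : e ≠ 2 ^ k) {x : ZMod (2 ^ k)} :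
    x ∈ gcdClass (2 ^ k) e ↔ ∃ b : ℕ, Odd b ∧ x = (e : ZMod (2 ^ k)) * b := by
  constructor
  · intro hx
    obtain ⟨b, hb, h⟩ := (gcd_two_pow_eq_iff he hne _).1 (mem_gcdClass.1 hx)
    refine ⟨b, hb, ?_⟩
    rw [← ZMod.natCast_zmod_val x, h]; push_cast; rfl
  · rintro ⟨b, hb, rfl⟩
    rw [← Nat.cast_mul]
    exact natCast_mem_gcdClass.2 ((gcd_two_pow_eq_iff he hne _).2 ⟨b, hb, rfl⟩)

lemma add_mem_gcdClass_two_pow {e : ℕ} (he : e ∣ 2 ^ k) (hne : e ≠ 2 ^ k) {x : ZMod (2 ^ k)}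
    (c : ℕ) (hx : x ∈ gcdClass (2 ^ k) e) : x + (2 * e * c : ℕ) ∈ gcdClass (2 ^ k) e := by
  rw [mem_gcdClass_two_pow_iff he hne] at hx ⊢
  obtain ⟨b, hb, rfl⟩ := hx
  refine ⟨b + 2 * c, hb.add_even (even_two_mul c), ?_⟩
  push_cast; ring

/-- The class is stable under translation by 2e. Either the character is trivial on that shift,
hence constant with value ±1 on the class, or the sum is zero. -/
lemma sum_gcdClass_stdAddChar_mem_int {e : ℕ} (he : e ∣ 2 ^ k) (r : ZMod (2 ^ k)) :
    ∃ z : ℤ, ∑ s ∈ gcdClass (2 ^ k) e, (ZMod.stdAddChar (r * s) : ℂ) = z := by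
  by_cases hne : e = 2 ^ k
  · subst hne
    exact ⟨1, by rw [gcdClass_self]; simp⟩
  set w : ℂ := ZMod.stdAddChar (r * ((2 * e : ℕ) : ZMod (2 ^ k))) with hw
  by_cases h1 : w = 1
  · have hconst : ∀ s ∈ gcdClass (2 ^ k) e,
        (ZMod.stdAddChar (r * s) : ℂ) = ZMod.stdAddChar (r * (e : ZMod (2 ^ k))) := by
      intro s hs
      obtain ⟨b, ⟨c, rfl⟩, rfl⟩ := (mem_gcdClass_two_pow_iff he hne).1 hs
      rw [show r * ((e : ZMod (2 ^ k)) * ((2 * c + 1 : ℕ) : ZMod (2 ^ k))) =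
        c • (r * ((2 * e : ℕ) : ZMod (2 ^ k))) + r * e by push_cast [nsmul_eq_mul]; ring,
        AddChar.map_add_eq_mul, AddChar.map_nsmul_eq_pow, ← hw, h1, one_pow, one_mul]
    rw [Finset.sum_congr rfl hconst, Finset.sum_const]
    have hsq : (ZMod.stdAddChar (r * (e : ZMod (2 ^ k))) : ℂ) ^ 2 = 1 := by
      rw [← AddChar.map_nsmul_eq_pow, ← h1, hw]
      congr 1
      push_cast [nsmul_eq_mul]; ring
    rcases (sq_eq_one_iff.1 hsq) with h | h
    · exact ⟨(gcdClass (2 ^ k) e).card, by rw [h]; simp⟩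
    · exact ⟨-(gcdClass (2 ^ k) e).card, by rw [h]; simp⟩
  · refine ⟨0, ?_⟩
    have hshift : ∑ s ∈ gcdClass (2 ^ k) e, (ZMod.stdAddChar (r * s) : ℂ) =
        w * ∑ s ∈ gcdClass (2 ^ k) e, (ZMod.stdAddChar (r * s) : ℂ) := by
      rw [Finset.mul_sum]
      -- The inverse shift, as a natural multiple of 2e, so that `add_mem_gcdClass_two_pow` covers
      -- it.
      have hn : ((2 * e * (2 ^ k - 1) : ℕ) : ZMod (2 ^ k)) = -((2 * e : ℕ) : ZMod (2 ^ k)) := by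
        have : ((2 ^ k : ℕ) : ZMod (2 ^ k)) = 0 := ZMod.natCast_self _
        push_cast [Nat.one_le_two_pow] at this ⊢
        rw [this]; ring
      refine (Finset.sum_nbij' (fun s => s + ((2 * e * 1 : ℕ) : ZMod (2 ^ k)))
        (fun s => s + ((2 * e * (2 ^ k - 1) : ℕ) : ZMod (2 ^ k)))
        (fun s hs => add_mem_gcdClass_two_pow he hne _ hs)
        (fun s hs => add_mem_gcdClass_two_pow he hne _ hs) ?_ ?_ ?_).symm
      · intro s _; simp only [hn]; simp
      · intro s _; simp only [hn]; simp
      · intro s _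
        rw [hw, ← AddChar.map_add_eq_mul]
        congr 1
        push_cast; ring
    have : (w - 1) * ∑ s ∈ gcdClass (2 ^ k) e, (ZMod.stdAddChar (r * s) : ℂ) = 0 := by
      rw [sub_mul, ← hshift]; ring
    rw [(mul_eq_zero.1 this).resolve_left (sub_ne_zero.2 h1)]
    simp

lemma circulantEigenvalue_mem_int {S : Finset (ZMod (2 ^ k))}
    (h : ∀ e, e ∣ 2 ^ k → (S ∩ gcdClass (2 ^ k) e).Nonempty →
      S ∩ gcdClass (2 ^ k) e = gcdClass (2 ^ k) e) (r : ZMod (2 ^ k)) :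
    ∃ z : ℤ, circulantEigenvalue S r = z := by
  have hcl : ∀ e ∈ (2 ^ k).divisors, ∃ z : ℤ,
      ∑ s ∈ S ∩ gcdClass (2 ^ k) e, (ZMod.stdAddChar (r * s) : ℂ) = z := by
    intro e he
    have he' := Nat.dvd_of_mem_divisors he
    by_cases hem : (S ∩ gcdClass (2 ^ k) e).Nonempty
    · rw [h e he' hem]
      exact sum_gcdClass_stdAddChar_mem_int he' r
    · rw [Finset.not_nonempty_iff_eq_empty.1 hem]
      exact ⟨0, by simp⟩
  choose! z hz using hcl
  refine ⟨∑ e ∈ (2 ^ k).divisors, z e, ?_⟩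
  push_cast
  rw [circulantEigenvalue, ← Finset.sum_fiberwise_of_maps_to
    (g := fun s : ZMod (2 ^ k) => Nat.gcd s.val (2 ^ k)) (t := (2 ^ k).divisors)
    (fun s _ => Nat.mem_divisors.2 ⟨Nat.gcd_dvd_right _ _, by positivity⟩)]
  refine Finset.sum_congr rfl fun e he => ?_
  rw [← hz e he]
  refine Finset.sum_congr ?_ fun _ _ => rfl
  ext s
  simp [mem_gcdClass]

/-- If n/d is 1, 2 or 4, any two elements of the class agree up to sign, so a symmetric set contains
all of it or none. -/
lemma eight_mul_dvd_of_ssubset {S : Finset (ZMod (2 ^ k))} (hsymm : ∀ s ∈ S, -s ∈ S) {d : ℕ}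
    (hd : d ∣ 2 ^ k) (hne : (S ∩ gcdClass (2 ^ k) d).Nonempty)
    (hss : S ∩ gcdClass (2 ^ k) d ⊂ gcdClass (2 ^ k) d) : 8 * d ∣ 2 ^ k := by
  obtain ⟨x, hx⟩ := hne
  obtain ⟨hxS, hxd⟩ := Finset.mem_inter.1 hx
  obtain ⟨y, hyd, hy⟩ := Finset.exists_of_ssubset hss
  have hyS : y ∉ S := fun h => hy (Finset.mem_inter.2 ⟨h, hyd⟩)
  by_cases hdn : d = 2 ^ k
  · subst hdn
    rw [gcdClass_self, Finset.mem_singleton] at hxd hyd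
    exact absurd (hyd.trans hxd.symm ▸ hxS) hyS
  obtain ⟨b, hb, rfl⟩ := (mem_gcdClass_two_pow_iff hd hdn).1 hxd
  obtain ⟨c, hc, rfl⟩ := (mem_gcdClass_two_pow_iff hd hdn).1 hyd
  obtain ⟨j, hj, rfl⟩ := (Nat.dvd_prime_pow Nat.prime_two).1 hd
  rw [show 8 * 2 ^ j = 2 ^ (3 + j) by rw [pow_add]; norm_num]
  by_contra hcon
  have hlt : ¬ 3 + j ≤ k := fun h => hcon (pow_dvd_pow 2 h)
  have h4 : ((4 * 2 ^ j : ℕ) : ZMod (2 ^ k)) = 0 := by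
    rw [ZMod.natCast_eq_zero_iff, show 4 * 2 ^ j = 2 ^ (2 + j) by rw [pow_add]; norm_num]
    exact pow_dvd_pow 2 (by omega)
  -- Two odd numbers agree up to sign modulo 4.
  have hbc : (∃ u : ℤ, (c : ℤ) = b + 4 * u) ∨ ∃ u : ℤ, (c : ℤ) = -b + 4 * u := by
    obtain ⟨b', rfl⟩ := hb
    obtain ⟨c', rfl⟩ := hc
    rcases Int.even_or_odd' ((c' : ℤ) - b') with ⟨u, hu | hu⟩
    · exact Or.inl ⟨u, by push_cast; linarith⟩
    · exact Or.inr ⟨b' + u + 1, by push_cast; linarith⟩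
  rcases hbc with ⟨u, hu⟩ | ⟨u, hu⟩
  · have hu' : (c : ZMod (2 ^ k)) = b + 4 * u := by
      have := congrArg (Int.cast : ℤ → ZMod (2 ^ k)) hu
      push_cast at this
      exact this
    refine hyS ?_
    convert hxS using 1
    rw [hu']; push_cast at h4 ⊢
    linear_combination (u : ZMod (2 ^ k)) * h4
  · have hu' : (c : ZMod (2 ^ k)) = -b + 4 * u := by
      have := congrArg (Int.cast : ℤ → ZMod (2 ^ k)) hu
      push_cast at this
      exact this
    refine hyS ?_
    convert hsymm _ hxS using 1
    rw [hu']; push_cast at h4 ⊢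
    linear_combination (u : ZMod (2 ^ k)) * h4

lemma sum_univ_eq_sum_range {n : ℕ} [NeZero n] {M : Type*} [AddCommMonoid M] (f : ZMod n → M) :
    ∑ x, f x = ∑ i ∈ Finset.range n, f i := by
  refine Finset.sum_nbij' ZMod.val (fun i => (i : ZMod n)) ?_ ?_ ?_ ?_ ?_
  · intro x _; simpa using ZMod.val_lt x
  · simp
  · simp
  · intro i hi; exact ZMod.val_cast_of_lt (Finset.mem_range.1 hi)
  · simp

/-- Negation and translation by n/2 generate a Klein four-group. A nontrivial element can fix x only
if x is a multiple of n/4, which 8e ∣ n rules out on the class, so all orbits have size 4. -/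
lemma four_dvd_sum_gcdClass {e : ℕ} (he : 8 * e ∣ 2 ^ k) {f : ZMod (2 ^ k) → ℤ}
    (hneg : ∀ x ∈ gcdClass (2 ^ k) e, f (-x) = f x)
    (hhalf : ∀ x ∈ gcdClass (2 ^ k) e, f (x + (2 ^ k / 2 : ℕ)) = f x) :
    4 ∣ ∑ x ∈ gcdClass (2 ^ k) e, f x := by
  obtain ⟨c, hc⟩ := he
  have hk : 0 < 2 ^ k := by positivity
  have he0 : 0 < e := Nat.pos_of_ne_zero fun h => by simp [h] at hc
  have hc0 : 0 < c := Nat.pos_of_ne_zero fun h => by simp [h] at hc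
  have hed : e ∣ 2 ^ k := ⟨8 * c, by rw [hc]; ring⟩
  -- M = n/4; the sum over one quarter of the residues will represent the orbits.
  set M := 2 * e * c with hM
  have hn : 2 ^ k = 2 * M + 2 * M := by rw [hc, hM]; ring
  have heM : e < M := by rw [hM]; nlinarith
  have hen : e ≠ 2 ^ k := by omega
  have hdiv : 2 ^ k / 2 = 2 * M := by omega
  rw [hdiv] at hhalf
  have hself : ((2 * M : ℕ) : ZMod (2 ^ k)) + (2 * M : ℕ) = 0 := by
    rw [← Nat.cast_add, ← hn]; exact ZMod.natCast_self _
  have hadd : ∀ x : ZMod (2 ^ k), x ∈ gcdClass (2 ^ k) e →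
      x + (2 * M : ℕ) ∈ gcdClass (2 ^ k) e := fun x hx => by
    have := add_mem_gcdClass_two_pow hed hen (2 * c) hx
    rwa [show 2 * e * (2 * c) = 2 * M by rw [hM]; ring] at this
  have hnegmem : ∀ x : ZMod (2 ^ k), x ∈ gcdClass (2 ^ k) e → -x ∈ gcdClass (2 ^ k) e := by
    intro x hx
    obtain ⟨b, hb, rfl⟩ := (mem_gcdClass_two_pow_iff hed hen).1 hx
    refine (mem_gcdClass_two_pow_iff hed hen).2 ⟨b * (2 ^ k - 1), hb.mul ?_, ?_⟩
    · rw [hn]; exact ⟨2 * M - 1, by omega⟩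
    · have : ((2 ^ k : ℕ) : ZMod (2 ^ k)) = 0 := ZMod.natCast_self _
      push_cast [Nat.one_le_two_pow] at this ⊢
      rw [this]; ring
  set h : ZMod (2 ^ k) → ℤ := fun x => if x ∈ gcdClass (2 ^ k) e then f x else 0 with hh
  have h1 : ∀ x, h (x + (2 * M : ℕ)) = h x := fun x => by
    by_cases hx : x ∈ gcdClass (2 ^ k) e
    · simp only [hh, if_pos hx, if_pos (hadd x hx), hhalf x hx]
    · have : x + (2 * M : ℕ) ∉ gcdClass (2 ^ k) e := fun h' => hx (by
        have := hadd _ h'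
        rwa [add_assoc, hself, add_zero] at this)
      simp only [hh, if_neg hx, if_neg this]
  have h2 : ∀ x, h (-x) = h x := fun x => by
    by_cases hx : x ∈ gcdClass (2 ^ k) e
    · simp only [hh, if_pos hx, if_pos (hnegmem x hx), hneg x hx]
    · have : -x ∉ gcdClass (2 ^ k) e := fun h' => hx (by
        have := hnegmem _ h'
        rwa [neg_neg] at this)
      simp only [hh, if_neg hx, if_neg this]
  have hzero : h ((0 : ℕ) : ZMod (2 ^ k)) = 0 := by
    refine if_neg fun h' => ?_
    rw [natCast_mem_gcdClass, Nat.gcd_zero_left] at h'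
    exact hen h'.symm
  have hMz : h (M : ℕ) = 0 := by
    refine if_neg fun h' => ?_
    rw [natCast_mem_gcdClass, hn, show 2 * M + 2 * M = M * 4 by ring, Nat.gcd_mul_right_right] at h'
    omega
  have h2M : h ((2 * M : ℕ) : ZMod (2 ^ k)) = 0 := by
    have := h1 0
    rw [zero_add] at this
    rw [this]; simpa using hzero
  have hsum : ∑ x ∈ gcdClass (2 ^ k) e, f x = ∑ x, h x := by
    rw [hh, Finset.sum_ite_mem, Finset.univ_inter]
  -- Reflection i ↦ 2M - i exchanges the closed intervals [0, M] and [M, 2M]; the vanishing of h at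
  -- M and 2M permits half-open ranges.
  have hrefl : ∑ i ∈ Finset.range M, h (M + i : ℕ) = ∑ i ∈ Finset.range M, h (i : ℕ) := by
    have h3 := Finset.sum_range_reflect (fun i => h (M + i : ℕ)) (M + 1)
    have h4 : ∀ i ∈ Finset.range (M + 1), h (M + (M + 1 - 1 - i) : ℕ) = h (i : ℕ) := by
      intro i hi
      have hi' : i ≤ M := Nat.lt_succ_iff.1 (Finset.mem_range.1 hi)
      have h5 : ((M + (M + 1 - 1 - i) : ℕ) : ZMod (2 ^ k)) = -(i : ZMod (2 ^ k)) + (2 * M : ℕ) := by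
        rw [show M + (M + 1 - 1 - i) = 2 * M - i by omega, Nat.cast_sub (by omega)]
        ring
      rw [h5, h1, h2]
    rw [Finset.sum_congr rfl h4, Finset.sum_range_succ, Finset.sum_range_succ, hMz, ← two_mul, h2M]
      at h3
    simpa using h3.symm
  have hper : ∀ i : ℕ, h ((2 * M + i : ℕ) : ZMod (2 ^ k)) = h (i : ℕ) := fun i => by
    rw [Nat.cast_add, add_comm, h1]
  rw [hsum, sum_univ_eq_sum_range]
  conv => enter [2, 1, 1]; rw [hn]
  rw [Finset.sum_range_add, Finset.sum_congr rfl fun i _ => hper i, two_mul M,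
    Finset.sum_range_add, hrefl]
  exact ⟨∑ i ∈ Finset.range M, h (i : ℕ), by ring⟩

end TwoPower

end CirculantPGST

namespace CirculantPGST

/-! ### Vanishing sums of 2^k-th roots of unity. -/

section Cyclotomic

/-- Powers of a primitive root of unity below the totient are linearly independent over `ℤ`. -/
lemma eq_zero_of_sum_mul_pow_eq_zero {n N : ℕ} (hn : 0 < n) (hN : N ≤ n.totient) {ζ : ℂ}
    (hζ : IsPrimitiveRoot ζ n) (c : ℕ → ℤ) (h : ∑ i ∈ Finset.range N, (c i : ℂ) * ζ ^ i = 0)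
    {i : ℕ} (hi : i < N) : c i = 0 := by
  set P : Polynomial ℤ := ∑ i ∈ Finset.range N, Polynomial.C (c i) * Polynomial.X ^ i with hP
  have hcoeff : P.coeff i = c i := by
    simp [hP, Polynomial.finsetSum_coeff, Polynomial.coeff_X_pow, hi]
  have hroot : Polynomial.aeval ζ P = 0 := by
    rw [hP, map_sum, ← h]
    refine Finset.sum_congr rfl fun i _ => ?_
    simp
  have hdvd : Polynomial.cyclotomic n ℤ ∣ P := by
    rw [Polynomial.cyclotomic_eq_minpoly hζ hn]
    exact minpoly.isIntegrallyClosed_dvd (hζ.isIntegral hn) hroot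
  have hdeg : P.degree < (Polynomial.cyclotomic n ℤ).degree := by
    rw [Polynomial.degree_cyclotomic]
    refine lt_of_lt_of_le ?_ (Nat.cast_le.2 hN)
    rw [hP, Finset.sum_range]
    exact Polynomial.degree_sum_fin_lt _
  rw [← hcoeff, Polynomial.eq_zero_of_dvd_of_degree_lt hdvd hdeg, Polynomial.coeff_zero]

variable {k : ℕ}

lemma stdAddChar_half (hk : 0 < k) :
    (ZMod.stdAddChar ((2 ^ k / 2 : ℕ) : ZMod (2 ^ k)) : ℂ) = -1 := by
  have hne : ((2 ^ k / 2 : ℕ) : ZMod (2 ^ k)) ≠ 0 := by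
    obtain ⟨k, rfl⟩ : ∃ l, k = l + 1 := ⟨k - 1, by omega⟩
    intro h
    rw [ZMod.natCast_eq_zero_iff, pow_succ, Nat.mul_div_cancel _ (by norm_num)] at h
    have := Nat.le_of_dvd (by positivity) h
    have : 0 < 2 ^ k := by positivity
    omega
  have hsq : (ZMod.stdAddChar ((2 ^ k / 2 : ℕ) : ZMod (2 ^ k)) : ℂ) ^ 2 = 1 := by
    rw [← AddChar.map_nsmul_eq_pow, nsmul_eq_mul, ← Nat.cast_mul,
      Nat.mul_div_cancel' (dvd_pow_self 2 hk.ne'), ZMod.natCast_self, AddChar.map_zero_eq_one]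
  refine (sq_eq_one_iff.1 hsq).resolve_left fun h => hne ?_
  exact ZMod.injective_stdAddChar (h.trans (AddChar.map_zero_eq_one _).symm)

/-- Since ζ ^ (n/2) = -1, the sum folds to coefficients f i - f (i + n/2) on the first n/2 powers of
ζ. As n/2 is the totient of n, these powers are independent. -/
lemma apply_add_half_of_sum_mul_stdAddChar_eq_zero (hk : 0 < k) (f : ZMod (2 ^ k) → ℤ)
    (h : ∑ x, (f x : ℂ) * ZMod.stdAddChar x = 0) (x : ZMod (2 ^ k)) :
    f (x + ((2 ^ k / 2 : ℕ) : ZMod (2 ^ k))) = f x := by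
  set ζ : ℂ := ZMod.stdAddChar (1 : ZMod (2 ^ k)) with hζ
  have hprim : IsPrimitiveRoot ζ (2 ^ k) := by
    rw [hζ, show (1 : ZMod (2 ^ k)) = ((1 : ℤ) : ZMod (2 ^ k)) by simp, ZMod.stdAddChar_coe]
    simpa using Complex.isPrimitiveRoot_exp (2 ^ k) (by positivity)
  have hpow : ∀ i : ℕ, (ZMod.stdAddChar (i : ZMod (2 ^ k)) : ℂ) = ζ ^ i := fun i => by
    rw [hζ, ← AddChar.map_nsmul_eq_pow, nsmul_eq_mul, mul_one]
  obtain ⟨N, hN⟩ : ∃ N, 2 ^ k = N + N :=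
    ⟨2 ^ (k - 1), by rw [← two_mul, ← pow_succ']; congr 1; omega⟩
  have hhalf : 2 ^ k / 2 = N := by omega
  have hζN : ζ ^ N = -1 := by rw [← hpow, ← hhalf, stdAddChar_half hk]
  rw [hhalf]
  have hself : ((N : ℕ) : ZMod (2 ^ k)) + N = 0 := by
    rw [← Nat.cast_add, ← hN]; exact ZMod.natCast_self _
  have hsum : ∑ i ∈ Finset.range N,
      (((fun i : ℕ => f (i : ℕ) - f (i + N)) i : ℤ) : ℂ) * ζ ^ i = 0 := by
    rw [← h, sum_univ_eq_sum_range]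
    conv => enter [2, 1, 1]; rw [hN]
    rw [Finset.sum_range_add, ← Finset.sum_add_distrib]
    refine Finset.sum_congr rfl fun i _ => ?_
    rw [hpow, hpow, pow_add, hζN, add_comm N i]
    push_cast
    ring
  have htot : N ≤ (2 ^ k).totient := by
    rw [Nat.totient_prime_pow Nat.prime_two hk]
    have : 2 ^ k = 2 * 2 ^ (k - 1) := by rw [← pow_succ']; congr 1; omega
    omega
  have hlow : ∀ i < N, f ((i : ℕ) + N) = f (i : ℕ) := fun i hi => by
    have := eq_zero_of_sum_mul_pow_eq_zero (by positivity) htot hprim _ hsum hi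
    linarith
  have hx : x = ((x.val : ℕ) : ZMod (2 ^ k)) := (ZMod.natCast_zmod_val x).symm
  by_cases hlt : x.val < N
  · rw [hx]; exact hlow _ hlt
  · have hv := ZMod.val_lt x
    obtain ⟨i, hi⟩ := Nat.exists_eq_add_of_le (not_lt.1 hlt)
    rw [hx, hi, Nat.cast_add, add_comm (N : ZMod (2 ^ k)) i, hlow i (by omega), add_assoc, hself,
      add_zero]

end Cyclotomic

/-! ### Parity of integer relations among the eigenvalues. -/

section Relations

variable {k : ℕ} {S : Finset (ZMod (2 ^ k))} {d : ℕ}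

/-- For odd r, multiplication preserves gcd classes and the count is |S ∩ S_n(d)|. For even r, a
solution s lies in a class e < d, which S contains entirely by minimality; its size is divisible by
4. -/
lemma card_filter_mul_mem_gcdClass_modEq (hd : 8 * d ∣ 2 ^ k)
    (hmin : ∀ e < d, e ∣ 2 ^ k → (S ∩ gcdClass (2 ^ k) e).Nonempty →
      S ∩ gcdClass (2 ^ k) e = gcdClass (2 ^ k) e)
    (hcard : (S ∩ gcdClass (2 ^ k) d).card ≡ 2 [MOD 4]) (r : ZMod (2 ^ k)) :
    ((S.filter fun s => r * s ∈ gcdClass (2 ^ k) d).card : ℤ) ≡ 2 * r.val [ZMOD 4] := by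
  have hpos : 0 < 2 ^ k := by positivity
  have hd' : d ∣ 2 ^ k := (dvd_mul_left d 8).trans hd
  have hd0 : 0 < d := Nat.pos_of_dvd_of_pos hd' hpos
  have hdn : d ≠ 2 ^ k := by
    have := Nat.le_of_dvd hpos hd
    omega
  have hmem : ∀ s : ZMod (2 ^ k), r * s ∈ gcdClass (2 ^ k) d ↔
      Nat.gcd r.val (2 ^ k) * Nat.gcd s.val (2 ^ k) = d := fun s => by
    rw [← gcd_mul_two_pow_eq_iff hd' hdn, ← natCast_mem_gcdClass]
    simp
  have hk : 2 ∣ 2 ^ k := (Dvd.intro (4 * d) (by ring) : 2 ∣ 8 * d).trans hd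
  rcases Nat.even_or_odd r.val with hr | hr
  · have h2 : (2 : ℤ) * r.val ≡ 0 [ZMOD 4] := by
      obtain ⟨c, hc⟩ := hr
      rw [hc]
      exact (Int.modEq_zero_iff_dvd).2 ⟨c, by push_cast; ring⟩
    refine Int.ModEq.trans ?_ h2.symm
    rw [Int.modEq_zero_iff_dvd]
    rcases (S.filter fun s => r * s ∈ gcdClass (2 ^ k) d).eq_empty_or_nonempty with h0 | ⟨s, hs⟩
    · rw [h0]; simp
    obtain ⟨hsS, hsd⟩ := Finset.mem_filter.1 hs
    rw [hmem] at hsd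
    set g := Nat.gcd r.val (2 ^ k) with hg
    set e := Nat.gcd s.val (2 ^ k) with he
    have hg2 : 2 ≤ g := Nat.le_of_dvd (Nat.gcd_pos_of_pos_right _ hpos) (Nat.dvd_gcd hr.two_dvd hk)
    have he0 : 0 < e := Nat.gcd_pos_of_pos_right _ hpos
    have hed : e < d := by nlinarith
    have hen : e ∣ 2 ^ k := Nat.gcd_dvd_right _ _
    have hfil : (S.filter fun s => r * s ∈ gcdClass (2 ^ k) d) = gcdClass (2 ^ k) e := by
      rw [← hmin e hed hen ⟨s, Finset.mem_inter.2 ⟨hsS, mem_gcdClass.2 rfl⟩⟩]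
      ext y
      rw [Finset.mem_filter, Finset.mem_inter, hmem, mem_gcdClass]
      refine and_congr_right fun _ => ⟨fun h => ?_, fun h => by rw [h, hsd]⟩
      exact Nat.eq_of_mul_eq_mul_left (by omega) (h.trans hsd.symm)
    rw [hfil]
    have h8 : 8 * e ∣ 2 ^ k := (Nat.mul_dvd_mul_left 8 (Dvd.intro_left _ hsd)).trans hd
    have := four_dvd_sum_gcdClass h8 (f := fun _ => 1) (fun _ _ => rfl) (fun _ _ => rfl)
    simpa using this
  · have hg : Nat.gcd r.val (2 ^ k) = 1 := Nat.Coprime.pow_right _ hr.coprime_two_right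
    have hfil : (S.filter fun s => r * s ∈ gcdClass (2 ^ k) d) = S ∩ gcdClass (2 ^ k) d := by
      ext y
      rw [Finset.mem_filter, Finset.mem_inter, hmem, mem_gcdClass, hg, one_mul]
    rw [hfil]
    refine ((Int.natCast_modEq_iff (n := 4)).2 hcard).trans ?_
    obtain ⟨c, hc⟩ := hr
    rw [hc]
    refine (Int.modEq_iff_dvd).2 ⟨c, ?_⟩
    push_cast; ring

/-- Every integral relation among the eigenvalues has an even weight on the odd characters. -/
lemma two_dvd_sum_mul_val (hsymm : ∀ s ∈ S, -s ∈ S) (hd : 8 * d ∣ 2 ^ k)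
    (hmin : ∀ e < d, e ∣ 2 ^ k → (S ∩ gcdClass (2 ^ k) e).Nonempty →
      S ∩ gcdClass (2 ^ k) e = gcdClass (2 ^ k) e)
    (hcard : (S ∩ gcdClass (2 ^ k) d).card ≡ 2 [MOD 4]) (l : ZMod (2 ^ k) → ℤ) (m : ℤ)
    (h : ∑ r, (l r : ℂ) * circulantEigenvalue S r = m) : 2 ∣ ∑ r, l r * (r.val : ℤ) := by
  have hpos : 0 < 2 ^ k := by positivity
  have hk : 0 < k := by
    rcases Nat.eq_zero_or_pos k with rfl | hk
    · have := Nat.le_of_dvd hpos hd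
      have : 0 < d := Nat.pos_of_ne_zero fun h0 => by simp [h0] at hd
      omega
    · exact hk
  obtain ⟨c, hc⟩ := hd
  have hd0 : 0 < d := Nat.pos_of_ne_zero fun h0 => by simp [h0] at hc
  have hc0 : 0 < c := Nat.pos_of_ne_zero fun h0 => by simp [h0] at hc
  have hd8 : 8 * d ∣ 2 ^ k := ⟨c, hc⟩
  have hdc : d ≤ d * c := Nat.le_mul_of_pos_right _ hc0
  have hc' : 2 ^ k = 8 * (d * c) := by rw [hc]; ring
  set p : ZMod (2 ^ k) → ℤ := fun x => ∑ r, ∑ s ∈ S, if r * s = x then l r else 0 with hp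
  have hpneg : ∀ x, p (-x) = p x := fun x => by
    refine Finset.sum_congr rfl fun r _ => ?_
    refine Finset.sum_nbij' (fun s => -s) (fun s => -s) hsymm hsymm (by simp) (by simp) ?_
    intro s _
    simp only [mul_neg, neg_eq_iff_eq_neg]
  have hpsum : ∑ x, (p x : ℂ) * ZMod.stdAddChar x = m := by
    rw [← h]
    simp only [hp, circulantEigenvalue, Int.cast_sum, Finset.sum_mul, Finset.mul_sum]
    rw [Finset.sum_comm]
    refine Finset.sum_congr rfl fun r _ => ?_
    rw [Finset.sum_comm]
    refine Finset.sum_congr rfl fun s _ => ?_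
    rw [Finset.sum_eq_single (r * s)]
    · simp
    · intro b _ hb; simp [hb.symm]
    · simp
  -- Subtracting m at x = 0 turns the relation into a vanishing sum; neither x nor x + n/2 is 0 on
  -- S_n(d), so the correction is invisible there.
  have hf := apply_add_half_of_sum_mul_stdAddChar_eq_zero hk
    (fun x => p x - if x = 0 then m else 0) (by
      simp only [Int.cast_sub, sub_mul, Finset.sum_sub_distrib, hpsum]
      rw [Finset.sum_eq_single (0 : ZMod (2 ^ k))]
      · simp
      · intro b _ hb; simp [hb]
      · simp)
  have hdvd : 4 ∣ ∑ x ∈ gcdClass (2 ^ k) d, p x := by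
    refine four_dvd_sum_gcdClass hd8 (fun x _ => hpneg x) fun x hx => ?_
    have h1 : x ≠ 0 := by
      rintro rfl
      rw [mem_gcdClass, ZMod.val_zero, Nat.gcd_zero_left] at hx
      omega
    have h2 : x + ((2 ^ k / 2 : ℕ) : ZMod (2 ^ k)) ≠ 0 := by
      intro h0
      have hdn : d ∣ 2 ^ k := (dvd_mul_left d 8).trans hd8
      have h3 := add_mem_gcdClass_two_pow hdn (by omega) (2 * c) hx
      rw [show 2 * d * (2 * c) = 2 ^ k / 2 by
        rw [hc', show 8 * (d * c) = 2 * (2 * d * (2 * c)) by ring]; simp, h0, mem_gcdClass,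
        ZMod.val_zero, Nat.gcd_zero_left] at h3
      omega
    have := hf x
    simpa [h1, h2] using this
  -- Double counting of the pairs (r, s) with rs in the class.
  have hswap : ∑ x ∈ gcdClass (2 ^ k) d, p x =
      ∑ r, l r * ((S.filter fun s => r * s ∈ gcdClass (2 ^ k) d).card : ℤ) := by
    simp only [hp]
    rw [Finset.sum_comm]
    refine Finset.sum_congr rfl fun r _ => ?_
    rw [Finset.sum_comm]
    simp only [Finset.sum_ite_eq]
    rw [← Finset.sum_filter, Finset.sum_const, nsmul_eq_mul, mul_comm]
  have hmod : ∑ r, l r * ((S.filter fun s => r * s ∈ gcdClass (2 ^ k) d).card : ℤ) ≡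
      ∑ r, l r * (2 * (r.val : ℤ)) [ZMOD 4] := by
    refine Int.ModEq.sum fun r _ => ?_
    exact (card_filter_mul_mem_gcdClass_modEq hd8 hmin hcard r).mul_left _
  have h4 : (4 : ℤ) ∣ ∑ r, l r * (2 * (r.val : ℤ)) := by
    rw [← Int.modEq_zero_iff_dvd]
    exact hmod.symm.trans ((Int.modEq_zero_iff_dvd).2 (hswap ▸ hdvd))
  have h5 : ∑ r, l r * (2 * (r.val : ℤ)) = 2 * ∑ r, l r * (r.val : ℤ) := by
    rw [Finset.mul_sum]
    exact Finset.sum_congr rfl fun r _ => by ring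
  rw [h5] at h4
  omega

end Relations

/-! ### From approximation to time sequences in 2πℤ. -/

section TimeSequence

variable {n : ℕ} [NeZero n]

lemma exists_tendsto_exp_circulantEigenvalue {S : Finset (ZMod n)} (hsymm : ∀ s ∈ S, -s ∈ S)
    (α : ZMod n → ℝ)
    (h : ∀ (l : ZMod n → ℤ) (m : ℤ), ∑ r, (l r : ℂ) * circulantEigenvalue S r = m →
      ∃ m' : ℤ, ∑ r, l r * α r = m') :
    ∃ t : ℕ → ℝ, (∀ m, ∃ z : ℤ, t m = 2 * Real.pi * z) ∧ Tendsto t atTop atTop ∧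
      ∀ r, Tendsto (fun m => Complex.exp (-(Complex.I * t m) * circulantEigenvalue S r)) atTop
        (𝓝 (Complex.exp (-(2 * Real.pi * Complex.I * α r)))) := by
  have hreal := circulantEigenvalue_eq_ofReal hsymm
  have hfreq : ∀ m : ℕ, ∃ q : ℕ, m ≤ q ∧ ∀ r, ‖Complex.exp (2 * Real.pi * Complex.I *
      (q * (circulantEigenvalue S r).re - α r)) - 1‖ < 1 / ((m : ℝ) + 1) := fun m => by
    have := frequently_norm_exp_sub_exp_lt (fun r => (circulantEigenvalue S r).re) α
      (fun l m hl => h l m (by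
        rw [Finset.sum_congr rfl fun r _ => congrArg _ (hreal r)]
        exact_mod_cast hl)) (ε := 1 / ((m : ℝ) + 1)) (by positivity)
    -- Requiring q ≥ m makes the times tend to infinity.
    obtain ⟨q, hq, hq'⟩ := (this.and_eventually (eventually_ge_atTop m)).exists
    exact ⟨q, hq', hq⟩
  choose q hq hqr using hfreq
  refine ⟨fun m => 2 * Real.pi * q m, fun m => ⟨q m, by simp⟩, ?_, fun r => ?_⟩
  · refine Tendsto.const_mul_atTop (by positivity) (tendsto_natCast_atTop_atTop.comp ?_)
    exact tendsto_atTop_mono hq tendsto_id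
  · have h1 : Tendsto (fun m => Complex.exp (2 * Real.pi * Complex.I *
        (q m * (circulantEigenvalue S r).re - α r))) atTop (𝓝 1) := by
      rw [tendsto_iff_norm_sub_tendsto_zero]
      exact squeeze_zero (fun _ => norm_nonneg _) (fun m => (hqr m r).le)
        tendsto_one_div_add_atTop_nhds_zero_nat
    have h2 := (h1.inv₀ one_ne_zero).mul_const (Complex.exp (-(2 * Real.pi * Complex.I * α r)))
    rw [inv_one, one_mul] at h2
    refine h2.congr fun m => ?_
    rw [← Complex.exp_neg, ← Complex.exp_add]
    congr 1
    conv_rhs => rw [hreal r]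
    push_cast
    ring

lemma tendsto_matrix_of_tendsto_mulVec_single {V : Type*} [Fintype V] [DecidableEq V]
    {M : ℕ → Matrix V V ℂ}
    (h : ∀ u, Tendsto (fun m => M m *ᵥ (Pi.single u 1 : V → ℂ)) atTop (𝓝 (Pi.single u 1))) :
    Tendsto M atTop (𝓝 1) := by
  refine tendsto_pi_nhds.2 fun v => tendsto_pi_nhds.2 fun u => ?_
  have := tendsto_pi_nhds.1 (h u) v
  simpa [Matrix.one_apply, Pi.single_apply] using this

end TimeSequence

end CirculantPGST

theorem theorem2p4 (k n : ℕ) [NeZero n] (hn : n = 2 ^ k)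
    (S : Finset (ZMod n)) (hzero : (0 : ZMod n) ∉ S) (hsymm : ∀ s ∈ S, -s ∈ S)
    (hnonint : ¬ CirculantPGST.IsIntegralGraph
      (SimpleGraph.circulantGraph (S : Set (ZMod n)))) :
    ∃ d : ℕ,
      IsLeast {e : ℕ | e ∣ n ∧ (S ∩ CirculantPGST.gcdClass n e).Nonempty ∧
        S ∩ CirculantPGST.gcdClass n e ⊂ CirculantPGST.gcdClass n e} d ∧
      ((S ∩ CirculantPGST.gcdClass n d).card ≡ 2 [MOD 4] →
        ∃ t : ℕ → ℝ, (∀ m, ∃ z : ℤ, t m = 2 * Real.pi * z) ∧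
          CirculantPGST.HasPGSTAlong (SimpleGraph.circulantGraph (S : Set (ZMod n)))
            (0 : ZMod n) ((n / 2 : ℕ) : ZMod n) t) ∧
      ((S ∩ CirculantPGST.gcdClass n d).card ≡ 0 [MOD 4] →
        ∃ t : ℕ → ℝ, (∀ m, ∃ z : ℤ, t m = 2 * Real.pi * z) ∧ Tendsto t atTop atTop ∧
          CirculantPGST.IsAlmostPeriodicAlong
            (SimpleGraph.circulantGraph (S : Set (ZMod n))) t) := by
  subst hn
  have hne : {e : ℕ | e ∣ 2 ^ k ∧ (S ∩ CirculantPGST.gcdClass (2 ^ k) e).Nonempty ∧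
      S ∩ CirculantPGST.gcdClass (2 ^ k) e ⊂ CirculantPGST.gcdClass (2 ^ k) e}.Nonempty := by
    by_contra hempty
    rw [Set.not_nonempty_iff_eq_empty, Set.eq_empty_iff_forall_notMem] at hempty
    refine hnonint fun μ hμ => ?_
    obtain ⟨r, rfl⟩ := CirculantPGST.exists_eq_circulantEigenvalue hzero hsymm hμ
    refine CirculantPGST.circulantEigenvalue_mem_int (fun e he hnon => ?_) r
    by_contra hcon
    exact hempty e ⟨he, hnon, Finset.inter_subset_right.ssubset_of_ne hcon⟩
  obtain ⟨d, hd⟩ : ∃ d, IsLeast {e : ℕ | e ∣ 2 ^ k ∧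
      (S ∩ CirculantPGST.gcdClass (2 ^ k) e).Nonempty ∧
      S ∩ CirculantPGST.gcdClass (2 ^ k) e ⊂ CirculantPGST.gcdClass (2 ^ k) e} d :=
    ⟨_, Nat.sInf_mem hne, fun _ he => Nat.sInf_le he⟩
  refine ⟨d, hd, fun hcard => ?_, fun _ => ?_⟩
  · have hd8 := CirculantPGST.eight_mul_dvd_of_ssubset hsymm hd.1.1 hd.1.2.1 hd.1.2.2
    have hk : 2 ∣ 2 ^ k := (Dvd.intro (4 * d) (by ring) : 2 ∣ 8 * d).trans hd8
    have hmin : ∀ e < d, e ∣ 2 ^ k → (S ∩ CirculantPGST.gcdClass (2 ^ k) e).Nonempty →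
        S ∩ CirculantPGST.gcdClass (2 ^ k) e = CirculantPGST.gcdClass (2 ^ k) e := by
      intro e he hen hnon
      by_contra hcon
      exact absurd (hd.2 ⟨hen, hnon, Finset.inter_subset_right.ssubset_of_ne hcon⟩) (not_le.2 he)
    obtain ⟨t, ht, -, hlim⟩ := CirculantPGST.exists_tendsto_exp_circulantEigenvalue hsymm
      -- The target phase exp(-πir) is the character value at -r(n/2).
      (fun r => (r.val : ℝ) / 2) (fun l m hl => by
        obtain ⟨z, hz⟩ := CirculantPGST.two_dvd_sum_mul_val hsymm hd8 hmin hcard l m hl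
        refine ⟨z, ?_⟩
        have hz' : ∑ r, (l r : ℝ) * (r.val : ℝ) = 2 * z := by exact_mod_cast hz
        simp_rw [mul_div_assoc']
        rw [← Finset.sum_div, hz']
        ring)
    refine ⟨t, ht, 1, norm_one, ?_⟩
    have := CirculantPGST.tendsto_transitionMatrix_mulVec_single hzero hsymm (t := t)
      (a := ((2 ^ k / 2 : ℕ) : ZMod (2 ^ k))) (fun r => by
        convert hlim r using 2
        have hr : -(r * ((2 ^ k / 2 : ℕ) : ZMod (2 ^ k))) =
            ((-(r.val * (2 ^ k / 2 : ℕ)) : ℤ) : ZMod (2 ^ k)) := by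
          rw [Int.cast_neg, Int.cast_mul, Int.cast_natCast, Int.cast_natCast,
            ZMod.natCast_zmod_val]
        rw [hr, ZMod.stdAddChar_coe]
        congr 1
        have h2 : (((2 ^ k : ℕ) : ℂ)) = 2 * ((2 ^ k / 2 : ℕ) : ℂ) := by
          exact_mod_cast (Nat.mul_div_cancel' hk).symm
        have h3 : ((2 ^ k / 2 : ℕ) : ℂ) ≠ 0 := by
          intro h0
          rw [h0, mul_zero] at h2
          exact absurd h2 (NeZero.ne _)
        rw [h2]
        simp only [Int.cast_neg, Int.cast_mul, Int.cast_natCast, Complex.ofReal_div,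
          Complex.ofReal_natCast, Complex.ofReal_ofNat]
        field_simp) 0
    simpa using this
  · obtain ⟨t, ht, htop, hlim⟩ := CirculantPGST.exists_tendsto_exp_circulantEigenvalue hsymm
      (fun _ => 0) (fun l m _ => ⟨0, by simp⟩)
    refine ⟨t, ht, htop, 1, norm_one, ?_⟩
    rw [one_smul]
    refine CirculantPGST.tendsto_matrix_of_tendsto_mulVec_single fun u => ?_
    have := CirculantPGST.tendsto_transitionMatrix_mulVec_single hzero hsymm (t := t) (a := 0)
      (fun r => by simpa using hlim r) u
    simpa using this
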